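/- Let $N\ge 1$, $B\ge 0$, and let $\phi(y,t)=t^{-1/2}\exp\!\big(y^2/(2t)\big)$, $[y]_+=\max\{y,0\}$, $t_0=\max\{512\,e^2B^2\log N,\,1\}$. NormalHedge.BH is the following strategy for prediction with $N$ experts. Start with $x_0=0\in\mathbb R^N$, time $t_0$ and $V_0=0$. In round $j=1,2,\dots$, write $\tilde x_{j-1,i}=[x_{j-1,i}]_+$. 1. The player plays the probability vector $p_j$ with $p_{j,i}\propto\partial_y\phi(\tilde x_{j-1,i},t_{j-1})$ (an arbitrary probability vector if all these weights vanish). 2. Nature reveals $\ell_j\in\mathbb R^N$ with $|\ell_{j,i}-\ell_{j,i'}|\le B$ for all $i,i'$. Put $\Delta x_{j,i}=\langle p_j,\ell_j\rangle-\ell_{j,i}$ and $x_j=x_{j-1}+\Delta x_j$. 3. The time becomes $t_j=t_{j-1}+\Delta t_j$, where $\Delta t_j\ge 0$ is the (unique) solution of $\sum_i\phi([x_{j,i}]_+,t_{j-1}+\Delta t_j)=\sum_i\phi(\tilde x_{j-1,i},t_{j-1})$. 4. $V_j=V_{j-1}+\sum_i q_{j,i}\,\Delta x_{j,i}^2$,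 where $q_j$ is the probability vector with $q_{j,i}\propto\partial^2_{yy}\phi(\tilde x_{j-1,i},t_{j-1})$. For $\varepsilon\in(0,1)$ let $\mathrm{Regret}_\varepsilon(T)$ be the $\lceil N\varepsilon\rceil$-th largest coordinate of $x_T$. Then, for every sequence of losses as above, every choice of the arbitrary vectors in step 1, every $\varepsilon\in(0,1)$ and every $T\ge1$, $$\mathrm{Regret}_\varepsilon(T)\le\sqrt{\big(t_0+V_T+\iota B\sqrt{V_T}\big)\big(\log(t_0+2V_T)+2\log(1/\varepsilon)\big)},\qquad \iota=\iota(V_T)=144\max\{1,\ \log(t_0+2V_T)+2\log N\}.$$ Moreover, this bound improves the constant factor of the bound $\sqrt{(t_0+2V_T)(\log(t_0+2V_T)+2\log(1/\varepsilon))}$ by $\sqrt2$ as $V_T\to\infty$: for fixed $N$, $B$ and $\varepsilon\in(0,1)$, $$\lim_{V\to\infty}\frac{\sqrt{(t_0+2V)(\log(t_0+2V)+2\log(1/\varepsilon))}}{\sqrt{\big(t_0+V+\iota(V) B\sqrt{V}\big)\big(\log(t_0+2V)+2\log(1/\varepsilon)\big)}}=\sqrt2 .$$ -/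

import Mathlib

open Filter Topology

noncomputable section

/-- Total potential `Φ(x, t) = ∑ i, φ (x i) t`. -/
def totalPotential {N : ℕ} (φ : ℝ → ℝ → ℝ) (x : Fin N → ℝ) (t : ℝ) : ℝ :=
  ∑ i, φ (x i) t

/-- State of the constant potential algorithm after a number of rounds: the regret vector `x`,
the time variable `t` and the accumulated second moment `V`. -/
structure CPState (N : ℕ) where
  x : Fin N → ℝ
  t : ℝ
  V : ℝ

/-- The distribution `p`, with `p i` proportional to `∂φ/∂y` at the projected regret of expert `i`.
If all these weights vanish, the player may use an arbitrary distribution `d`. -/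
def cpPlay {N : ℕ} (φ : ℝ → ℝ → ℝ) (proj : ℝ → ℝ) (d : Fin N → ℝ) (s : CPState N) :
    Fin N → ℝ := fun i =>
  open Classical in
  if ∀ k, deriv (fun y => φ y s.t) (proj (s.x k)) = 0 then d i
  else deriv (fun y => φ y s.t) (proj (s.x i)) / ∑ k, deriv (fun y => φ y s.t) (proj (s.x k))

/-- The distribution `q`, with `q i` proportional to `∂²φ/∂y²` at the projected regret of
expert `i`. -/
def cpSecond {N : ℕ} (φ : ℝ → ℝ → ℝ) (proj : ℝ → ℝ) (s : CPState N) : Fin N → ℝ := fun i =>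
  iteratedDeriv 2 (fun y => φ y s.t) (proj (s.x i)) /
    ∑ k, iteratedDeriv 2 (fun y => φ y s.t) (proj (s.x k))

/-- Instantaneous regret vector `⟨p, ℓ⟩ 1 - ℓ`. -/
def instRegret {N : ℕ} (p ℓ : Fin N → ℝ) : Fin N → ℝ := fun i => ∑ k, p k * ℓ k - ℓ i

/-- The time increment: the `τ ≥ 0` for which the total potential at the new projected regret
vector `y'` and time `t + τ` equals the one at the old projected regret vector `y` and time `t`.
For the potentials of interest it exists and is unique, so the infimum is its value. -/
def cpTimeStep {N : ℕ} (φ : ℝ → ℝ → ℝ) (y y' : Fin N → ℝ) (t : ℝ) : ℝ :=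
  sInf {τ : ℝ | 0 ≤ τ ∧ totalPotential φ y' (t + τ) = totalPotential φ y t}

/-- One round of the constant potential algorithm on the loss vector `ℓ`. -/
def cpStep {N : ℕ} (φ : ℝ → ℝ → ℝ) (proj : ℝ → ℝ) (d ℓ : Fin N → ℝ) (s : CPState N) :
    CPState N where
  x := s.x + instRegret (cpPlay φ proj d s) ℓ
  t := s.t + cpTimeStep φ (fun i => proj (s.x i))
    (fun i => proj (s.x i + instRegret (cpPlay φ proj d s) ℓ i)) s.t
  V := s.V + ∑ i, cpSecond φ proj s i * instRegret (cpPlay φ proj d s) ℓ i ^ 2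

/-- State of the constant potential algorithm started at time `t₀` after `T` rounds; round `j + 1`
has the loss vector `ℓ j`, and `d j` is the player's arbitrary choice in case all weights vanish. -/
def cpState {N : ℕ} (φ : ℝ → ℝ → ℝ) (proj : ℝ → ℝ) (t₀ : ℝ) (d ℓ : ℕ → Fin N → ℝ) :
    ℕ → CPState N
  | 0 => ⟨0, t₀, 0⟩
  | j + 1 => cpStep φ proj (d j) (ℓ j) (cpState φ proj t₀ d ℓ j)

/-- The potential `φ(y, t) = t^(-1/2) exp(y² / (2t))`. -/
def phiNH (y t : ℝ) : ℝ := t ^ (-(1 / 2) : ℝ) * Real.exp (y ^ 2 / (2 * t))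

/-- Initial time `t₀ = max {512 e² B² log N, 1}`. -/
def initialTime (N : ℕ) (B : ℝ) : ℝ :=
  max (512 * Real.exp 1 ^ 2 * B ^ 2 * Real.log N) 1

/-- NormalHedge.BH: the constant potential algorithm for `phiNH` and the domain `[0, ∞)`, started
at `initialTime N B`. -/
def normalHedgeBH {N : ℕ} (B : ℝ) (d ℓ : ℕ → Fin N → ℝ) (T : ℕ) : CPState N :=
  cpState phiNH (fun y => max y 0) (initialTime N B) d ℓ T

/-- The `k`-th largest coordinate of `x` (for `1 ≤ k ≤ N`), that is, the largest `a` such that at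
least `k` coordinates are at least `a`. -/
def kthLargest {N : ℕ} (x : Fin N → ℝ) (k : ℕ) : ℝ :=
  sSup {a : ℝ | k ≤ (Finset.univ.filter fun i => a ≤ x i).card}

/-- Regret against the `⌈N ε⌉`-th best expert, for the regret vector `x`. -/
def quantileRegret {N : ℕ} (x : Fin N → ℝ) (ε : ℝ) : ℝ := kthLargest x ⌈(N : ℝ) * ε⌉₊

/-- The bound `√((t₀ + 2V)(log(t₀ + 2V) + 2 log(1/ε)))`. -/
def mainBound (N : ℕ) (B V ε : ℝ) : ℝ :=
  √((initialTime N B + 2 * V) *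
    (Real.log (initialTime N B + 2 * V) + 2 * Real.log (1 / ε)))

/-- The factor `ι = 144 max {1, log(t₀ + 2V) + 2 log N}`. -/
def iotaFactor (N : ℕ) (B V : ℝ) : ℝ :=
  144 * max 1 (Real.log (initialTime N B + 2 * V) + 2 * Real.log N)

/-- The bound `√((t₀ + V + ι B √V)(log(t₀ + 2V) + 2 log(1/ε)))`. -/
def improvedBound (N : ℕ) (B V ε : ℝ) : ℝ :=
  √((initialTime N B + V + iotaFactor N B V * B * √V) *
    (Real.log (initialTime N B + 2 * V) + 2 * Real.log (1 / ε)))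

end

/-! The total potential keeps its initial value `N * phiNH 0 t₀`. If at least `N * ε` coordinates
exceed `a ≥ 0`, then `ε * phiNH a t ≤ phiNH 0 t₀`, and taking logarithms gives `a² ≤ t * (log t + 2
log (1/ε))`. It remains to bound the clock `t` by `V`. The potential solves the backward heat
equation `∂ₜφ = -½ ∂²φ/∂y²`. In one round the first-order term vanishes by the choice of `p`, and
the second-order term is `½ ∑ ∂²φ/∂y² * (δ² - τ)`. So the time increment is the increment `v` of
`V`, up to a relative error `30η` with `η² = B² (1 + M) / t`, where `M` bounds every `y² / t`
(`totalPotential_add_le`, `cpStep_phiNH_spec`). The choice of `t₀` forces `η ≤ 1/30`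
(`sq_mul_div_le_of_initialTime_le`), whence `t ≤ t₀ + 2V`. Since `η` decays like `B / √t` up to
logarithms, the errors `η * v` are dominated by increments of `√V` and telescope to `ι B √V`
(`NormalHedgeInvariant.step`). The limit holds because `ι` grows only logarithmically. -/

/-! ### Derivatives, monotonicity and continuity of the potential. -/

theorem phiNH_eq_exp {t : ℝ} (ht : 0 < t) (y : ℝ) :
    phiNH y t = Real.exp (-(1 / 2) * Real.log t + y ^ 2 / (2 * t)) := by
  rw [phiNH, Real.rpow_def_of_pos ht, ← Real.exp_add]
  congr 1
  ring

theorem phiNH_pos {t : ℝ} (ht : 0 < t) (y : ℝ) : 0 < phiNH y t := by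
  rw [phiNH_eq_exp ht]
  exact Real.exp_pos _

theorem hasDerivAt_phiNH (y t : ℝ) :
    HasDerivAt (fun y => phiNH y t) (y / t * phiNH y t) y := by
  have h : HasDerivAt (fun y : ℝ => y ^ 2 / (2 * t)) (y / t) y := by
    have := (hasDerivAt_pow 2 y).div_const (2 * t)
    refine this.congr_deriv ?_
    norm_num [mul_div_mul_left]
  have := (h.exp).const_mul (t ^ (-(1 / 2) : ℝ))
  unfold phiNH
  refine this.congr_deriv ?_
  ring

theorem deriv_phiNH (y t : ℝ) : deriv (fun y => phiNH y t) y = y / t * phiNH y t :=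
  (hasDerivAt_phiNH y t).deriv

theorem iteratedDeriv_two_phiNH (y t : ℝ) :
    iteratedDeriv 2 (fun y => phiNH y t) y = (1 + y ^ 2 / t) / t * phiNH y t := by
  have h1 : deriv (fun y => phiNH y t) = fun y => y / t * phiNH y t :=
    funext fun y => deriv_phiNH y t
  rw [iteratedDeriv_succ, iteratedDeriv_one, h1]
  have h2 := ((hasDerivAt_id y).div_const t).mul (hasDerivAt_phiNH y t)
  have h3 := h2.deriv
  simp only [id] at h3
  refine Eq.trans h3 ?_
  ring

theorem phiNH_le_of_sq_le {t y y' : ℝ} (ht : 0 < t) (h : y ^ 2 ≤ y' ^ 2) :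
    phiNH y t ≤ phiNH y' t := by
  rw [phiNH_eq_exp ht, phiNH_eq_exp ht]
  gcongr

/-- Tangent inequality for the convex function `y ↦ φ(max y 0, t)`. -/
theorem phiNH_tangent_le {t : ℝ} (ht : 0 < t) (x δ : ℝ) :
    phiNH (max x 0) t + max x 0 / t * phiNH (max x 0) t * δ ≤ phiNH (max (x + δ) 0) t := by
  set y := max x 0 with hy
  set y' := max (x + δ) 0 with hy'
  -- Projection only helps: for `x ≥ 0` it can only raise the new point, and for `x ≤ 0` the slope
  -- is zero.
  have h1 : y * δ ≤ y * (y' - y) := by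
    rcases le_total 0 x with hx | hx
    · have : y = x := max_eq_left hx
      have h2 : x + δ ≤ y' := le_max_left _ _
      apply mul_le_mul_of_nonneg_left _ (le_max_right _ _)
      linarith
    · have : y = 0 := max_eq_right hx
      simp [this]
  have h2 : 1 + (y' ^ 2 - y ^ 2) / (2 * t) ≤ Real.exp ((y' ^ 2 - y ^ 2) / (2 * t)) := by
    rw [add_comm]
    exact Real.add_one_le_exp _
  have h3 : phiNH y' t = phiNH y t * Real.exp ((y' ^ 2 - y ^ 2) / (2 * t)) := by
    rw [phiNH_eq_exp ht, phiNH_eq_exp ht, ← Real.exp_add]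
    congr 1
    ring
  have h4 : y * δ / t ≤ (y' ^ 2 - y ^ 2) / (2 * t) := by
    rw [div_le_div_iff₀ ht (by positivity)]
    nlinarith [sq_nonneg (y' - y)]
  rw [h3]
  have h5 := mul_le_mul_of_nonneg_left ((add_le_add_right h4 1).trans h2) (phiNH_pos ht y).le
  refine le_trans (le_of_eq ?_) h5
  ring

theorem continuousOn_totalPotential_phiNH {N : ℕ} (y : Fin N → ℝ) {t : ℝ} (ht : 0 < t) :
    ContinuousOn (fun τ => totalPotential phiNH y (t + τ)) (Set.Ici 0) := by
  unfold totalPotential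
  refine continuousOn_finsetSum _ fun i _ => ?_
  have hpos : ∀ τ ∈ Set.Ici (0 : ℝ), 0 < t + τ := fun τ hτ => add_pos_of_pos_of_nonneg ht hτ
  have : ContinuousOn
      (fun τ => Real.exp (-(1 / 2) * Real.log (t + τ) + y i ^ 2 / (2 * (t + τ)))) (Set.Ici 0) := by
    refine Real.continuous_exp.comp_continuousOn (ContinuousOn.add ?_ ?_)
    · exact continuousOn_const.mul ((by fun_prop : ContinuousOn (fun τ : ℝ => t + τ) _).log
        fun τ hτ => (hpos τ hτ).ne')
    · exact continuousOn_const.div (by fun_prop) fun τ hτ => (by have := hpos τ hτ; positivity)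
  exact this.congr fun τ hτ => phiNH_eq_exp (hpos τ hτ) _

/-! ### Second-order expansion of the potential with explicit error. -/

theorem exp_le_quadratic_add_cube {x : ℝ} (hx : |x| ≤ 1) :
    Real.exp x ≤ 1 + x + x ^ 2 / 2 + |x| ^ 3 := by
  have h := Real.exp_bound hx (n := 3) (by norm_num)
  have h1 := (abs_le.1 h).2
  norm_num [Finset.sum_range_succ, Nat.factorial] at h1
  nlinarith [pow_nonneg (abs_nonneg x) 3]

/-- Second-order expansion of the logarithm of `φ(z + e, 1 + h) / φ(z, 1)`. -/
theorem log_ratio_le {z e b h η : ℝ} (hz : 0 ≤ z) (he : |e| ≤ b) (hh : 0 ≤ h)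
    (hhb : h ≤ 2 * b ^ 2) (hη0 : 0 ≤ η) (hη : η ≤ 1 / 30) (hb : b ^ 2 * (1 + z ^ 2) ≤ η ^ 2) :
    -(1 / 2) * Real.log (1 + h) + (z + e) ^ 2 / (2 * (1 + h)) - z ^ 2 / 2 ≤
      z * e + e ^ 2 / 2 - h * (1 + z ^ 2) / 2 + 2 * η * (h * (1 + z ^ 2)) := by
  have hb0 : 0 ≤ b := (abs_nonneg e).trans he
  have hzb : z * b ≤ η := abs_le_of_sq_le_sq' (by nlinarith [sq_nonneg b]) hη0 |>.2
  have hb2 : b ^ 2 ≤ η ^ 2 := by nlinarith [mul_nonneg (sq_nonneg b) (sq_nonneg z)]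
  have hη2 : η ^ 2 ≤ η / 30 := by nlinarith
  have he2 : e ^ 2 ≤ b ^ 2 := sq_le_sq.2 (he.trans (le_abs_self b))
  have hlog : h - h ^ 2 / 2 ≤ Real.log (1 + h) := by
    refine le_trans ?_ (Real.le_log_one_add_of_nonneg hh)
    rw [le_div_iff₀ (by linarith)]
    nlinarith [pow_nonneg hh 3]
  have hinv : (z + e) ^ 2 / (2 * (1 + h)) ≤ (z + e) ^ 2 / 2 * (1 - h + h ^ 2) := by
    rw [div_le_iff₀ (by positivity)]
    nlinarith [mul_nonneg (sq_nonneg (z + e)) (pow_nonneg hh 3)]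
  have hze : -(z * e) ≤ η := by
    have := mul_le_mul_of_nonneg_left ((neg_le_abs e).trans he) hz
    linarith
  have hze2 : (z + e) ^ 2 ≤ 2 * z ^ 2 + 2 * b ^ 2 := by nlinarith [sq_nonneg (z - e)]
  have h1 : h * (-(z * e)) ≤ h * η := mul_le_mul_of_nonneg_left hze hh
  have h2 : h ^ 2 * (z + e) ^ 2 ≤ h ^ 2 * (2 * z ^ 2 + 2 * b ^ 2) :=
    mul_le_mul_of_nonneg_left hze2 (sq_nonneg h)
  have h3 : h ≤ η / 15 := by linarith
  have h4 : h ^ 2 * (1 + z ^ 2) ≤ η / 15 * (h * (1 + z ^ 2)) := by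
    have := mul_le_mul_of_nonneg_right h3 (by positivity : 0 ≤ h * (1 + z ^ 2))
    nlinarith
  have h5 : h ^ 2 * b ^ 2 ≤ h ^ 2 / 4 := by nlinarith [sq_nonneg h]
  have h6 : 0 ≤ h * η := mul_nonneg hh hη0
  have h7 : 0 ≤ h * η * z ^ 2 := by positivity
  have h8 : 0 ≤ h ^ 2 * z ^ 2 := by positivity
  have h9 : 0 ≤ h * e ^ 2 := by positivity
  nlinarith

/-- The exponent is at most `z * e + R` with `|R| ≤ W / 2`, `W = (1 + z²)(e² + h)`. As `|z * e| ≤ η`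
and `W ≤ 3η²`, every term of its square and cube other than `z² e²` is `O(η W)`; the term `z² e² /
2` completes `e² / 2` to `(1 + z²) e² / 2`. -/
theorem exp_log_ratio_le {z e b h η : ℝ} (hz : 0 ≤ z) (he : |e| ≤ b) (hh : 0 ≤ h)
    (hhb : h ≤ 2 * b ^ 2) (hη0 : 0 ≤ η) (hη : η ≤ 1 / 30) (hb : b ^ 2 * (1 + z ^ 2) ≤ η ^ 2) :
    Real.exp (-(1 / 2) * Real.log (1 + h) + (z + e) ^ 2 / (2 * (1 + h)) - z ^ 2 / 2) ≤
      1 + z * e + (1 + z ^ 2) * (e ^ 2 - h) / 2 + 5 * η * ((1 + z ^ 2) * (e ^ 2 + h)) := by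
  refine (Real.exp_le_exp.2 (log_ratio_le hz he hh hhb hη0 hη hb)).trans ?_
  have he2 : e ^ 2 ≤ b ^ 2 := sq_le_sq.2 (he.trans (le_abs_self b))
  have hη2 : η ^ 2 ≤ η / 30 := by nlinarith
  have hr : 0 < 1 + z ^ 2 := by positivity
  obtain ⟨g, hg⟩ : ∃ g, g = h * (1 + z ^ 2) := ⟨_, rfl⟩
  obtain ⟨W, hW⟩ : ∃ W, W = (1 + z ^ 2) * e ^ 2 + g := ⟨_, rfl⟩
  obtain ⟨R, hR⟩ : ∃ R, R = e ^ 2 / 2 - g / 2 + 2 * η * g := ⟨_, rfl⟩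
  have hg0 : 0 ≤ g := hg ▸ by positivity
  have hu : (1 + z ^ 2) * e ^ 2 ≤ η ^ 2 := by
    have := mul_le_mul_of_nonneg_left he2 hr.le
    linarith
  have hg2 : g ≤ 2 * η ^ 2 := by
    have := mul_le_mul_of_nonneg_right hhb hr.le
    linarith
  have hze2 : 0 ≤ z ^ 2 * e ^ 2 := by positivity
  have he0 : 0 ≤ e ^ 2 := sq_nonneg e
  have hW0 : 0 ≤ W := by rw [hW]; positivity
  have hW3 : W ≤ 3 * η ^ 2 := by linarith
  have hηg : η * g ≤ g / 30 := by nlinarith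
  have hηg0 : 0 ≤ η * g := mul_nonneg hη0 hg0
  have hRW : |R| ≤ W / 2 := abs_le.2 ⟨by nlinarith, by nlinarith⟩
  have hze : |z * e| ≤ η := abs_le_of_sq_le_sq (by nlinarith) hη0
  have hX : z * e + e ^ 2 / 2 - h * (1 + z ^ 2) / 2 + 2 * η * (h * (1 + z ^ 2)) = z * e + R := by
    rw [hR, hg]
    ring
  rw [hX]
  have hY : |z * e + R| ≤ 21 / 20 * η := (abs_add_le _ _).trans (by linarith)
  have hexp := exp_le_quadratic_add_cube (hY.trans (by linarith))
  have hcross : z * e * R ≤ η * (W / 2) := by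
    refine (le_abs_self _).trans ?_
    rw [abs_mul]
    exact mul_le_mul hze hRW (abs_nonneg _) hη0
  have hRsq : R ^ 2 ≤ η * W / 40 := by
    have h1 : R ^ 2 ≤ (W / 2) ^ 2 := sq_le_sq.2 (hRW.trans (le_abs_self _))
    have h2 : W * W ≤ (η / 10) * W := mul_le_mul_of_nonneg_right (by linarith) hW0
    nlinarith
  have hsq : (z * e + R) ^ 2 ≤ z ^ 2 * e ^ 2 + 41 / 40 * (η * W) := by nlinarith
  have hηW : η * W ≤ W / 30 := by nlinarith
  have hηW0 : 0 ≤ η * W := mul_nonneg hη0 hW0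
  have hsq2 : (z * e + R) ^ 2 ≤ 21 / 20 * W := by linarith
  have hcube : |z * e + R| ^ 3 ≤ 21 / 20 * η * (21 / 20 * W) := by
    rw [pow_succ', sq_abs]
    exact mul_le_mul hY hsq2 (sq_nonneg _) (by positivity)
  have hWe : (1 + z ^ 2) * (e ^ 2 + h) = W := by rw [hW, hg]; ring
  have hWd : (1 + z ^ 2) * (e ^ 2 - h) = (1 + z ^ 2) * e ^ 2 - g := by rw [hg]; ring
  rw [hWe, hWd, mul_assoc]
  have hgW : η * g ≤ η * W := mul_le_mul_of_nonneg_left (by linarith) hη0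
  linarith

/-- Second-order upper bound for `φ` after a small change of both variables. -/
theorem phiNH_add_le {t y δ τ B η : ℝ} (ht : 0 < t) (hy : 0 ≤ y) (hδ : |δ| ≤ B) (hτ : 0 ≤ τ)
    (hτB : τ ≤ 2 * B ^ 2) (hη0 : 0 ≤ η) (hη : η ≤ 1 / 30)
    (hB : B ^ 2 * (1 + y ^ 2 / t) / t ≤ η ^ 2) :
    phiNH (y + δ) (t + τ) ≤ phiNH y t * (1 + y * δ / t + (1 + y ^ 2 / t) * (δ ^ 2 - τ) / (2 * t)
      + 5 * η * ((1 + y ^ 2 / t) * (δ ^ 2 + τ) / t)) := by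
  have hs := Real.sqrt_pos.2 ht
  have hs2 : √t ^ 2 = t := Real.sq_sqrt ht.le
  -- Parabolic scaling reduces to time `1`.
  have key := exp_log_ratio_le (z := y / √t) (e := δ / √t) (b := B / √t) (h := τ / t) (η := η)
    (by positivity) (by rw [abs_div, abs_of_pos hs]; gcongr) (by positivity)
    (by rw [div_pow, hs2, mul_div_assoc']; gcongr) hη0 hη
    (by rw [div_pow, div_pow, hs2]; exact le_trans (le_of_eq (by ring)) hB)
  have hlog : Real.log (t + τ) = Real.log t + Real.log (1 + τ / t) := by
    rw [← Real.log_mul ht.ne' (by positivity)]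
    congr 1
    field_simp
  have heq : phiNH (y + δ) (t + τ) = phiNH y t * Real.exp (-(1 / 2) * Real.log (1 + τ / t) +
      (y / √t + δ / √t) ^ 2 / (2 * (1 + τ / t)) - (y / √t) ^ 2 / 2) := by
    rw [phiNH_eq_exp (by positivity), phiNH_eq_exp ht, ← Real.exp_add, hlog, ← add_div, div_pow,
      div_pow, hs2]
    congr 1
    field_simp
    ring
  rw [heq]
  refine mul_le_mul_of_nonneg_left (key.trans (le_of_eq ?_)) (phiNH_pos ht y).le
  simp only [div_pow, hs2]
  have : y / √t * (δ / √t) = y * δ / t := by rw [div_mul_div_comm, ← sq, hs2]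
  rw [this]
  field_simp

/-- After the first-order term cancels, the remainder is `(½ + 5η) S - (½ - 5η)(1 + 30η) S = -5η (1
- 30η) S`, which is nonpositive exactly because `η ≤ 1/30`. -/
theorem totalPotential_add_le {N : ℕ} {y δ : Fin N → ℝ} {t τ B η : ℝ} (ht : 0 < t)
    (hy : ∀ i, 0 ≤ y i) (hδ : ∀ i, |δ i| ≤ B) (hτ : 0 ≤ τ) (hτB : τ ≤ 2 * B ^ 2)
    (hη0 : 0 ≤ η) (hη : η ≤ 1 / 30) (hB : ∀ i, B ^ 2 * (1 + y i ^ 2 / t) / t ≤ η ^ 2)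
    (horth : ∑ i, y i / t * phiNH (y i) t * δ i = 0)
    (hτS : τ * ∑ i, (1 + y i ^ 2 / t) / t * phiNH (y i) t =
      (1 + 30 * η) * ∑ i, (1 + y i ^ 2 / t) / t * phiNH (y i) t * δ i ^ 2) :
    totalPotential phiNH (fun i => y i + δ i) (t + τ) ≤ totalPotential phiNH y t := by
  set S₀ := ∑ i, (1 + y i ^ 2 / t) / t * phiNH (y i) t with hS₀
  set S := ∑ i, (1 + y i ^ 2 / t) / t * phiNH (y i) t * δ i ^ 2 with hS
  have hSnn : 0 ≤ S := Finset.sum_nonneg fun i _ => by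
    have := (phiNH_pos ht (y i)).le
    positivity
  have h1 : totalPotential phiNH (fun i => y i + δ i) (t + τ) ≤ ∑ i, (phiNH (y i) t +
      y i / t * phiNH (y i) t * δ i +
      (1 / 2 + 5 * η) * ((1 + y i ^ 2 / t) / t * phiNH (y i) t * δ i ^ 2) +
      (5 * η - 1 / 2) * τ * ((1 + y i ^ 2 / t) / t * phiNH (y i) t)) := by
    refine Finset.sum_le_sum fun i _ => ?_
    refine (phiNH_add_le ht (hy i) (hδ i) hτ hτB hη0 hη (hB i)).trans (le_of_eq ?_)
    field_simp
    ring
  refine h1.trans ?_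
  simp only [Finset.sum_add_distrib, ← Finset.mul_sum, horth, ← hS₀, ← hS]
  unfold totalPotential
  have h2 : 0 ≤ η * S := mul_nonneg hη0 hSnn
  have h3 : η * (η * S) ≤ η * S / 30 := by nlinarith
  rw [mul_assoc (5 * η - 1 / 2), hτS]
  nlinarith

/-! ### The played distribution and the instantaneous regret. -/

section Play

variable {N : ℕ} {φ : ℝ → ℝ → ℝ} {proj : ℝ → ℝ} {d ℓ : Fin N → ℝ} {s : CPState N} {B : ℝ}

theorem cpPlay_mem_stdSimplex (hd : d ∈ stdSimplex ℝ (Fin N))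
    (hw : ∀ k, 0 ≤ deriv (fun y => φ y s.t) (proj (s.x k))) :
    cpPlay φ proj d s ∈ stdSimplex ℝ (Fin N) := by
  unfold cpPlay
  split_ifs with h
  · exact hd
  · push Not at h
    obtain ⟨k, hk⟩ := h
    have hpos : 0 < ∑ k, deriv (fun y => φ y s.t) (proj (s.x k)) :=
      Finset.sum_pos' (fun i _ => hw i) ⟨k, Finset.mem_univ k, (hw k).lt_of_ne' hk⟩
    refine ⟨fun i => div_nonneg (hw i) hpos.le, ?_⟩
    rw [← Finset.sum_div, div_self hpos.ne']

theorem abs_instRegret_le {p : Fin N → ℝ} (hp : p ∈ stdSimplex ℝ (Fin N))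
    (hℓ : ∀ i i', |ℓ i - ℓ i'| ≤ B) (i : Fin N) : |instRegret p ℓ i| ≤ B := by
  have h : instRegret p ℓ i = ∑ k, p k * (ℓ k - ℓ i) := by
    simp only [instRegret, mul_sub, Finset.sum_sub_distrib, ← Finset.sum_mul, hp.2, one_mul]
  rw [h]
  calc |∑ k, p k * (ℓ k - ℓ i)| ≤ ∑ k, |p k * (ℓ k - ℓ i)| := Finset.abs_sum_le_sum_abs _ _
    _ ≤ ∑ k, p k * B := Finset.sum_le_sum fun k _ => by
        rw [abs_mul, abs_of_nonneg (hp.1 k)]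
        exact mul_le_mul_of_nonneg_left (hℓ k i) (hp.1 k)
    _ = B := by rw [← Finset.sum_mul, hp.2, one_mul]

theorem sum_deriv_mul_instRegret_cpPlay
    (hw : ∀ k, 0 ≤ deriv (fun y => φ y s.t) (proj (s.x k))) :
    ∑ i, deriv (fun y => φ y s.t) (proj (s.x i)) * instRegret (cpPlay φ proj d s) ℓ i = 0 := by
  by_cases h : ∀ k, deriv (fun y => φ y s.t) (proj (s.x k)) = 0
  · simp [h]
  · have hp : ∀ i, cpPlay φ proj d s i = deriv (fun y => φ y s.t) (proj (s.x i)) /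
        ∑ k, deriv (fun y => φ y s.t) (proj (s.x k)) := fun i => by rw [cpPlay, if_neg h]
    push Not at h
    obtain ⟨k, hk⟩ := h
    have hpos : 0 < ∑ k, deriv (fun y => φ y s.t) (proj (s.x k)) :=
      Finset.sum_pos' (fun i _ => hw i) ⟨k, Finset.mem_univ k, (hw k).lt_of_ne' hk⟩
    simp only [instRegret, hp, mul_sub, Finset.sum_sub_distrib, ← Finset.sum_mul, div_mul_eq_mul_div,
      ← Finset.sum_div]
    rw [mul_div_cancel₀ _ hpos.ne', sub_self]

end Play

/-! ### One round of the algorithm. -/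

/-- The time step is attained and bounded by any `K` at which the potential has dropped to its old
value. -/
theorem cpTimeStep_spec {N : ℕ} {y y' : Fin N → ℝ} {t K : ℝ} (ht : 0 < t) (hK : 0 ≤ K)
    (h0 : totalPotential phiNH y t ≤ totalPotential phiNH y' t)
    (h1 : totalPotential phiNH y' (t + K) ≤ totalPotential phiNH y t) :
    0 ≤ cpTimeStep phiNH y y' t ∧ cpTimeStep phiNH y y' t ≤ K ∧
      totalPotential phiNH y' (t + cpTimeStep phiNH y y' t) = totalPotential phiNH y t := by
  have hcont := continuousOn_totalPotential_phiNH y' ht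
  obtain ⟨τ, hτ, hτe⟩ := intermediate_value_Icc' hK
    (hcont.mono Set.Icc_subset_Ici_self) ⟨h1, by simpa using h0⟩
  have hclosed : IsClosed {τ : ℝ | 0 ≤ τ ∧
      totalPotential phiNH y' (t + τ) = totalPotential phiNH y t} :=
    hcont.preimage_isClosed_of_isClosed isClosed_Ici isClosed_singleton
  have hbdd : BddBelow {τ : ℝ | 0 ≤ τ ∧
      totalPotential phiNH y' (t + τ) = totalPotential phiNH y t} := ⟨0, fun _ h => h.1⟩
  have hmem := hclosed.csInf_mem ⟨τ, hτ.1, hτe⟩ hbdd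
  exact ⟨hmem.1, (csInf_le hbdd ⟨hτ.1, hτe⟩).trans hτ.2, hmem.2⟩

/-- The effect of one round of NormalHedge.BH on the potential, the time and the second moment. -/
theorem cpStep_phiNH_spec {N : ℕ} (hN : 1 ≤ N) {d ℓ : Fin N → ℝ} {s s' : CPState N} {B η : ℝ}
    (hs' : s' = cpStep phiNH (fun y => max y 0) d ℓ s) (hd : d ∈ stdSimplex ℝ (Fin N)) (hℓ : ∀ i i', |ℓ i - ℓ i'| ≤ B) (ht : 0 < s.t)
    (hη0 : 0 ≤ η) (hη : η ≤ 1 / 30)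
    (hB : ∀ i, B ^ 2 * (1 + max (s.x i) 0 ^ 2 / s.t) / s.t ≤ η ^ 2) :
    totalPotential phiNH (fun i => max (s'.x i) 0) s'.t =
      totalPotential phiNH (fun i => max (s.x i) 0) s.t ∧ s.t ≤ s'.t ∧
      s'.t ≤ s.t + (1 + 30 * η) * (s'.V - s.V) ∧ s.V ≤ s'.V ∧ s'.V ≤ s.V + B ^ 2 := by
  subst hs'
  set s' := cpStep phiNH (fun y => max y 0) d ℓ s
  set δ := instRegret (cpPlay phiNH (fun y => max y 0) d s) ℓ with hδdef
  set y : Fin N → ℝ := fun i => max (s.x i) 0 with hy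
  have hy0 : ∀ i, 0 ≤ y i := fun i => le_max_right _ _
  have hw : ∀ k, 0 ≤ deriv (fun y => phiNH y s.t) (max (s.x k) 0) := fun k => by
    rw [deriv_phiNH]
    exact mul_nonneg (div_nonneg (hy0 k) ht.le) (phiNH_pos ht _).le
  have hδ : ∀ i, |δ i| ≤ B :=
    abs_instRegret_le (cpPlay_mem_stdSimplex (proj := fun y => max y 0) hd hw) hℓ
  have horth : ∑ i, y i / s.t * phiNH (y i) s.t * δ i = 0 := by
    have := sum_deriv_mul_instRegret_cpPlay (proj := fun y => max y 0) (d := d) (ℓ := ℓ) hw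
    simpa only [deriv_phiNH] using this
  set c : Fin N → ℝ := fun i => (1 + y i ^ 2 / s.t) / s.t * phiNH (y i) s.t with hc
  have hcpos : ∀ i, 0 < c i := fun i => by
    have := phiNH_pos ht (y i)
    simp only [hc]
    positivity
  have : Nonempty (Fin N) := ⟨⟨0, hN⟩⟩
  have hS₀ : 0 < ∑ i, c i := Finset.sum_pos (fun i _ => hcpos i) Finset.univ_nonempty
  set v := s'.V - s.V with hv
  have hvS : v * ∑ i, c i = ∑ i, c i * δ i ^ 2 := by
    have h1 : v = ∑ i, cpSecond phiNH (fun y => max y 0) s i * δ i ^ 2 := by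
      simp only [hv, s', cpStep, add_sub_cancel_left, hδdef]
    rw [h1]
    have hq : ∀ i, cpSecond phiNH (fun y => max y 0) s i = c i / ∑ k, c k := fun i => by
      simp only [cpSecond, iteratedDeriv_two_phiNH, hc, hy]
    simp only [hq, div_mul_eq_mul_div, ← Finset.sum_div]
    rw [mul_div_cancel_right₀ _ hS₀.ne']
  have hv0 : 0 ≤ v := by
    refine nonneg_of_mul_nonneg_left ?_ hS₀
    rw [hvS]
    exact Finset.sum_nonneg fun i _ => mul_nonneg (hcpos i).le (sq_nonneg _)
  have hvB : v ≤ B ^ 2 := by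
    refine le_of_mul_le_mul_right ?_ hS₀
    rw [hvS, Finset.mul_sum]
    refine Finset.sum_le_sum fun i _ => ?_
    rw [mul_comm]
    exact mul_le_mul_of_nonneg_right (sq_le_sq.2 ((hδ i).trans (le_abs_self B))) (hcpos i).le
  -- By time `(1 + 30η) v` the potential has fallen back to its old value, so the actual increment
  -- is no larger.
  have hK : 0 ≤ (1 + 30 * η) * v := by positivity
  have hKB : (1 + 30 * η) * v ≤ 2 * B ^ 2 := by nlinarith
  have hup := totalPotential_add_le ht hy0 hδ hK hKB hη0 hη hB horth
    (by rw [mul_assoc, hvS])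
  have hKt : 0 < s.t + (1 + 30 * η) * v := by positivity
  have h1 : totalPotential phiNH (fun i => max (s.x i + δ i) 0) (s.t + (1 + 30 * η) * v) ≤
      totalPotential phiNH y s.t := by
    -- The expansion is at `y + δ`, possibly negative; the projected new regret has a smaller
    -- square.
    refine le_trans (Finset.sum_le_sum fun i _ => phiNH_le_of_sq_le hKt ?_) hup
    change max (s.x i + δ i) 0 ^ 2 ≤ _
    rcases le_total (s.x i + δ i) 0 with h | h
    · rw [max_eq_right h]
      simpa using sq_nonneg _
    · have h2 : s.x i ≤ y i := le_max_left _ _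
      rw [max_eq_left h]
      exact pow_le_pow_left₀ h (by linarith) 2
  have h0 : totalPotential phiNH y s.t ≤
      totalPotential phiNH (fun i => max (s.x i + δ i) 0) s.t := by
    have h2 := Finset.sum_le_sum fun i (_ : i ∈ Finset.univ) => phiNH_tangent_le ht (s.x i) (δ i)
    rw [Finset.sum_add_distrib, horth, add_zero] at h2
    exact h2
  obtain ⟨hτ0, hτK, hτe⟩ := cpTimeStep_spec ht hK h0 h1
  refine ⟨hτe, ?_, ?_, by linarith, by linarith⟩
  · exact le_add_of_nonneg_right hτ0
  · exact add_le_add_right hτK s.t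

/-! ### The invariant relating time, potential and second moment. -/

theorem one_le_initialTime (N : ℕ) (B : ℝ) : 1 ≤ initialTime N B := le_max_right _ _

/-- A bound on the potential gives a bound on its first argument. -/
theorem sq_div_le_of_phiNH_le {a c t t₀ : ℝ} (ht : 0 < t) (ht₀ : 0 < t₀) (hc : 0 < c)
    (h : c * phiNH a t ≤ phiNH 0 t₀) :
    a ^ 2 / t ≤ Real.log t - Real.log t₀ + 2 * Real.log (1 / c) := by
  rw [phiNH_eq_exp ht, phiNH_eq_exp ht₀] at h
  nth_rw 1 [← Real.exp_log hc] at h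
  rw [← Real.exp_add, Real.exp_le_exp] at h
  have h1 : a ^ 2 / (2 * t) = a ^ 2 / t / 2 := by rw [mul_comm, div_div]
  rw [h1, zero_pow two_ne_zero, zero_div] at h
  rw [one_div, Real.log_inv]
  linarith

/-- With `log t - log t₀ ≤ t / t₀ - 1`, the left side is at most `B² (1 + 2 log N) / t₀`. For `N ≥
2` this is small, since `log 2 > 0.69` lets `t₀` control `B²` as well as `B² log N`. -/
theorem sq_mul_div_le_of_initialTime_le {N : ℕ} {B t : ℝ} (hNB : B = 0 ∨ 2 ≤ N)
    (ht : initialTime N B ≤ t) :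
    B ^ 2 * (1 + (Real.log t - Real.log (initialTime N B) + 2 * Real.log N)) / t ≤
      (1 / 30) ^ 2 := by
  have ht₀1 := one_le_initialTime N B
  have hA : 512 * Real.exp 1 ^ 2 * B ^ 2 * Real.log N ≤ initialTime N B := le_max_left _ _
  set t₀ := initialTime N B
  have ht₀ : 0 < t₀ := by linarith
  have htpos : 0 < t := by linarith
  rcases hNB with rfl | hN
  · simp
  have hlogN : 0.69 ≤ Real.log N := by
    have h2 : Real.log 2 ≤ Real.log N := Real.log_le_log two_pos (by exact_mod_cast hN)
    linarith [Real.log_two_gt_d9]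
  have he : 7.38 ≤ Real.exp 1 ^ 2 := by nlinarith [Real.exp_one_gt_d9]
  have hBl : 0 ≤ B ^ 2 * Real.log N := mul_nonneg (sq_nonneg B) (by linarith)
  have h1 : 3778 * (B ^ 2 * Real.log N) ≤ t₀ := by nlinarith
  have h2 : 2606 * B ^ 2 ≤ t₀ := by nlinarith [sq_nonneg B]
  have hlog : Real.log t - Real.log t₀ ≤ t / t₀ - 1 := by
    rw [← Real.log_div htpos.ne' ht₀.ne']
    exact Real.log_le_sub_one_of_pos (by positivity)
  have h3 : 2606 * B ^ 2 * (t / t₀) ≤ t := by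
    calc 2606 * B ^ 2 * (t / t₀) ≤ t₀ * (t / t₀) := by gcongr
      _ = t := by field_simp
  have h4 : B ^ 2 * (Real.log t - Real.log t₀) ≤ B ^ 2 * (t / t₀ - 1) :=
    mul_le_mul_of_nonneg_left hlog (sq_nonneg B)
  rw [div_le_iff₀ htpos]
  nlinarith

theorem iotaFactor_mono {N : ℕ} {B V V' : ℝ} (hV : 0 ≤ V) (h : V ≤ V') :
    iotaFactor N B V ≤ iotaFactor N B V' := by
  have := one_le_initialTime N B
  unfold iotaFactor
  gcongr

/-- Invariant of NormalHedge.BH. -/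
structure NormalHedgeInvariant (N : ℕ) (B : ℝ) (s : CPState N) : Prop where
  le_t : initialTime N B ≤ s.t
  V_nonneg : 0 ≤ s.V
  potential : totalPotential phiNH (fun i => max (s.x i) 0) s.t = N * phiNH 0 (initialTime N B)
  t_le : s.t ≤ initialTime N B + 2 * s.V
  t_le' : s.t ≤ initialTime N B + s.V + iotaFactor N B s.V * B * √s.V

/-- A Markov-type bound. It is used with `c = 1 / N` for single coordinates and with `c = ε` for the
quantile. -/
theorem NormalHedgeInvariant.mul_phiNH_le {N : ℕ} {B : ℝ} {s : CPState N}
    (hs : NormalHedgeInvariant N B s) {a c : ℝ} (ha : 0 ≤ a) (hN : 1 ≤ N)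
    (hc : N * c ≤ (Finset.univ.filter fun i => a ≤ max (s.x i) 0).card) :
    c * phiNH a s.t ≤ phiNH 0 (initialTime N B) := by
  have ht : 0 < s.t := by linarith [hs.le_t, one_le_initialTime N B]
  have hN' : (0 : ℝ) < N := by exact_mod_cast hN
  have h1 : (Finset.univ.filter fun i => a ≤ max (s.x i) 0).card * phiNH a s.t ≤
      N * phiNH 0 (initialTime N B) := by
    rw [← hs.potential, ← nsmul_eq_mul]
    refine (Finset.card_nsmul_le_sum _ (fun i => phiNH (max (s.x i) 0) s.t) _ fun i hi => ?_).trans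
      (Finset.sum_le_sum_of_subset_of_nonneg (Finset.filter_subset _ _)
        fun i _ _ => (phiNH_pos ht _).le)
    exact phiNH_le_of_sq_le ht (pow_le_pow_left₀ ha (Finset.mem_filter.1 hi).2 2)
  have h2 := (mul_le_mul_of_nonneg_right hc (phiNH_pos ht a).le).trans h1
  rw [mul_assoc] at h2
  exact le_of_mul_le_mul_left h2 hN'

theorem NormalHedgeInvariant.step {N : ℕ} (hN : 1 ≤ N) {B : ℝ} (hB : 0 ≤ B)
    (hNB : B = 0 ∨ 2 ≤ N) {s : CPState N} (hs : NormalHedgeInvariant N B s) {d ℓ : Fin N → ℝ}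
    (hd : d ∈ stdSimplex ℝ (Fin N)) (hℓ : ∀ i i', |ℓ i - ℓ i'| ≤ B) :
    NormalHedgeInvariant N B (cpStep phiNH (fun y => max y 0) d ℓ s) := by
  have ht₀1 := one_le_initialTime N B
  obtain ⟨hle, hV, hpot, ht2, htι⟩ := id hs
  have ht : 0 < s.t := by linarith
  have hN' : (0 : ℝ) < N := by exact_mod_cast hN
  have hlogN : 0 ≤ Real.log N := Real.log_natCast_nonneg N
  set t₀ := initialTime N B with ht₀
  have hlogt₀ : 0 ≤ Real.log t₀ := Real.log_nonneg ht₀1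
  have hlogt : Real.log t₀ ≤ Real.log s.t := Real.log_le_log (by linarith) hle
  obtain ⟨M, hM⟩ : ∃ M, M = Real.log s.t - Real.log t₀ + 2 * Real.log N := ⟨_, rfl⟩
  have hM0 : 0 ≤ M := by linarith
  obtain ⟨η, hη⟩ : ∃ η, η = √(B ^ 2 * (1 + M) / s.t) := ⟨_, rfl⟩
  have hη0 : 0 ≤ η := hη ▸ Real.sqrt_nonneg _
  have hη2 : η ^ 2 = B ^ 2 * (1 + M) / s.t := by
    rw [hη, Real.sq_sqrt (by positivity)]
  have hη30 : η ≤ 1 / 30 := by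
    refine abs_le_of_sq_le_sq' ?_ (by norm_num) |>.2
    rw [hη2, hM]
    exact sq_mul_div_le_of_initialTime_le hNB hle
  have hMi : ∀ i, max (s.x i) 0 ^ 2 / s.t ≤ M := fun i => by
    have h := hs.mul_phiNH_le (a := max (s.x i) 0) (c := 1 / N) (le_max_right _ _) hN (by
      rw [mul_one_div_cancel hN'.ne']
      rw [Nat.one_le_cast, Nat.one_le_iff_ne_zero, Finset.card_ne_zero]
      exact ⟨i, Finset.mem_filter.2 ⟨Finset.mem_univ i, le_rfl⟩⟩)
    have h2 := sq_div_le_of_phiNH_le ht (by linarith) (by positivity) h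
    rwa [one_div_one_div, ← ht₀, ← hM] at h2
  obtain ⟨s', hs'⟩ : ∃ s', s' = cpStep phiNH (fun y => max y 0) d ℓ s := ⟨_, rfl⟩
  obtain ⟨hpot', htt', ht', hVV', hVB⟩ := cpStep_phiNH_spec hN hs' hd hℓ ht hη0 hη30
    (fun i => by rw [hη2]; gcongr; exact hMi i)
  rw [← hs']
  have hV' : 0 ≤ s'.V := hV.trans hVV'
  have hv : 0 ≤ s'.V - s.V := by linarith
  have hηv : η * (s'.V - s.V) ≤ 1 / 30 * (s'.V - s.V) := mul_le_mul_of_nonneg_right hη30 hv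
  have hstep2 : s'.t ≤ s.t + 2 * (s'.V - s.V) := by linarith
  have hι0 : 0 ≤ iotaFactor N B s'.V := by unfold iotaFactor; positivity
  refine ⟨hle.trans htt', hV', hpot'.trans hpot, by linarith, ?_⟩
  -- If the clock lags, the crude bound `τ ≤ 2v` suffices. Otherwise `s'.V ≤ s.t`, which makes `η`
  -- small relative to `1 / √s'.V`.
  rcases le_total (s.t + (s'.V - s.V)) (t₀ + s.V) with hcase | hcase
  · have : 0 ≤ iotaFactor N B s'.V * B * √s'.V := by positivity
    linarith
  have hB2 : B ^ 2 ≤ t₀ / 900 := by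
    have h := sq_mul_div_le_of_initialTime_le (t := t₀) hNB le_rfl
    rw [div_le_iff₀ (by linarith), ← ht₀] at h
    nlinarith [mul_nonneg (sq_nonneg B) hlogN]
  have hVt : s'.V ≤ s.t := by linarith
  set m := max 1 (Real.log (t₀ + 2 * s'.V) + 2 * Real.log N) with hm
  have hm1 : 1 ≤ m := le_max_left _ _
  have hMm : M ≤ m := by
    have : Real.log s.t ≤ Real.log (t₀ + 2 * s'.V) := Real.log_le_log ht (by linarith)
    exact le_trans (by linarith) (le_max_right _ _)
  have hst : 0 < √s.t := Real.sqrt_pos.2 ht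
  have hηm : η * √s.t ≤ 3 / 2 * (B * m) := by
    refine abs_le_of_sq_le_sq' ?_ (by positivity) |>.2
    rw [mul_pow, hη2, Real.sq_sqrt ht.le, div_mul_cancel₀ _ ht.ne']
    have : 1 + M ≤ 2 * m ^ 2 := by nlinarith
    have h1 := mul_le_mul_of_nonneg_left this (sq_nonneg B)
    have h2 := sq_nonneg (B * m)
    linarith
  have hsV : √s.V ≤ √s'.V := Real.sqrt_le_sqrt hVV'
  have hsVt : √s'.V ≤ √s.t := Real.sqrt_le_sqrt hVt
  -- The factor `√s.t` cancels the decay of `η`, leaving a telescoping increment of `√V`.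
  have hdiff : s'.V - s.V ≤ (√s'.V - √s.V) * (2 * √s.t) := by
    have h1 := Real.sq_sqrt hV
    have h2 := Real.sq_sqrt hV'
    have h3 := mul_nonneg (sub_nonneg.2 hsV) (by linarith : 0 ≤ 2 * √s.t - √s.V - √s'.V)
    nlinarith
  have hmain : 30 * η * (s'.V - s.V) ≤ 144 * m * B * (√s'.V - √s.V) := by
    calc 30 * η * (s'.V - s.V) ≤ 30 * η * ((√s'.V - √s.V) * (2 * √s.t)) := by gcongr
      _ = 60 * (√s'.V - √s.V) * (η * √s.t) := by ring
      _ ≤ 60 * (√s'.V - √s.V) * (3 / 2 * (B * m)) := by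
        have := sub_nonneg.2 hsV
        gcongr
      _ ≤ 144 * m * B * (√s'.V - √s.V) := by
        have h1 : 0 ≤ m * B * (√s'.V - √s.V) :=
          mul_nonneg (mul_nonneg (by linarith) hB) (sub_nonneg.2 hsV)
        linarith
  have hιm : iotaFactor N B s'.V = 144 * m := by rw [hm, ht₀, iotaFactor]
  have hιmono : iotaFactor N B s.V * B * √s.V ≤ 144 * m * B * √s.V := by
    rw [← hιm]
    gcongr
    exact iotaFactor_mono hV hVV'
  rw [hιm]
  linarith

theorem normalHedgeInvariant_normalHedgeBH {N : ℕ} (hN : 1 ≤ N) {B : ℝ} (hB : 0 ≤ B)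
    (hNB : B = 0 ∨ 2 ≤ N) {d ℓ : ℕ → Fin N → ℝ} (hd : ∀ j, d j ∈ stdSimplex ℝ (Fin N))
    (hℓ : ∀ j i i', |ℓ j i - ℓ j i'| ≤ B) (T : ℕ) :
    NormalHedgeInvariant N B (normalHedgeBH B d ℓ T) := by
  induction T with
  | zero =>
    constructor <;> simp [normalHedgeBH, cpState, totalPotential]
  | succ j ih => exact ih.step hN hB hNB (hd j) (hℓ j)

theorem NormalHedgeInvariant.quantileRegret_le {N : ℕ} (hN : 1 ≤ N) {B : ℝ}
    {s : CPState N} (hs : NormalHedgeInvariant N B s) {ε : ℝ} (hε : 0 < ε) (hε1 : ε < 1) :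
    quantileRegret s.x ε ≤ improvedBound N B s.V ε := by
  have ht₀1 := one_le_initialTime N B
  have ht : 0 < s.t := by linarith [hs.le_t]
  have hN' : (0 : ℝ) < N := by exact_mod_cast hN
  have hlogε : 0 ≤ Real.log (1 / ε) := Real.log_nonneg (one_le_one_div hε hε1.le)
  refine Real.sSup_le (fun a ha => ?_) (Real.sqrt_nonneg _)
  rcases le_total a 0 with ha0 | ha0
  · exact ha0.trans (Real.sqrt_nonneg _)
  have hcard : N * ε ≤ (Finset.univ.filter fun i => a ≤ max (s.x i) 0).card := by
    refine (Nat.le_ceil _).trans ?_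
    have h1 : (Finset.univ.filter fun i => a ≤ s.x i).card ≤
        (Finset.univ.filter fun i => a ≤ max (s.x i) 0).card :=
      Finset.card_le_card fun i hi => by
        simp only [Finset.mem_filter, Finset.mem_univ, true_and] at hi ⊢
        exact hi.trans (le_max_left _ _)
    exact_mod_cast (show ⌈(N : ℝ) * ε⌉₊ ≤ _ from ha).trans h1
  have h := sq_div_le_of_phiNH_le ht (by linarith) hε (hs.mul_phiNH_le ha0 hN hcard)
  refine Real.le_sqrt_of_sq_le ?_
  rw [div_le_iff₀ ht] at h
  have hlogt : Real.log s.t ≤ Real.log (initialTime N B + 2 * s.V) := Real.log_le_log ht hs.t_le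
  have hlogt0 : 0 ≤ Real.log s.t := Real.log_nonneg (by linarith [hs.le_t])
  have hlogt₀ : 0 ≤ Real.log (initialTime N B) := Real.log_nonneg ht₀1
  refine h.trans ?_
  rw [mul_comm]
  refine (mul_le_mul_of_nonneg_left (?_ : _ ≤ Real.log (initialTime N B + 2 * s.V) +
    2 * Real.log (1 / ε)) ht.le).trans (mul_le_mul_of_nonneg_right hs.t_le' ?_) <;> linarith

/-! ### The regret bound, including a single expert. -/

theorem quantileRegret_normalHedgeBH_le {N : ℕ} (hN : 1 ≤ N) {B : ℝ} (hB : 0 ≤ B)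
    {d ℓ : ℕ → Fin N → ℝ} (hd : ∀ j, d j ∈ stdSimplex ℝ (Fin N))
    (hℓ : ∀ j i i', |ℓ j i - ℓ j i'| ≤ B) {ε : ℝ} (hε : 0 < ε) (hε1 : ε < 1) (T : ℕ) :
    quantileRegret (normalHedgeBH B d ℓ T).x ε ≤
      improvedBound N B (normalHedgeBH B d ℓ T).V ε := by
  rcases hN.eq_or_lt' with rfl | h2
  -- For `N = 1`, `log N = 0` and `t₀` does not control `B`. But all loss differences vanish, so the
  -- invariant applies with `B = 0`.
  · have ht₀ : initialTime 1 0 = initialTime 1 B := by simp [initialTime]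
    have hnh : normalHedgeBH B d ℓ T = normalHedgeBH 0 d ℓ T := by
      rw [normalHedgeBH, normalHedgeBH, ht₀]
    have hinv := normalHedgeInvariant_normalHedgeBH (ℓ := ℓ) hN le_rfl (Or.inl rfl) hd
      (fun j i i' => by rw [Subsingleton.elim i i']; simp) T
    rw [hnh]
    have ht₀1 := one_le_initialTime 1 B
    have hV := hinv.V_nonneg
    refine (hinv.quantileRegret_le hN hε hε1).trans (Real.sqrt_le_sqrt ?_)
    rw [ht₀]
    refine mul_le_mul_of_nonneg_right ?_ ?_
    · have : 0 ≤ iotaFactor 1 B (normalHedgeBH 0 d ℓ T).V * B * √(normalHedgeBH 0 d ℓ T).V := by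
        unfold iotaFactor
        positivity
      linarith
    · have h1 : 0 ≤ Real.log (1 / ε) := Real.log_nonneg (one_le_one_div hε hε1.le)
      have h2 : 0 ≤ Real.log (initialTime 1 B + 2 * (normalHedgeBH 0 d ℓ T).V) :=
        Real.log_nonneg (by linarith)
      linarith
  · exact (normalHedgeInvariant_normalHedgeBH hN hB (Or.inr h2) hd hℓ T).quantileRegret_le
      hN hε hε1

/-! ### Asymptotic comparison of the two bounds. -/

theorem tendsto_iotaFactor_mul_sqrt_div (N : ℕ) (B : ℝ) :
    Tendsto (fun V : ℝ => iotaFactor N B V * B * √V / V) atTop (𝓝 0) := by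
  have ht₀1 := one_le_initialTime N B
  set t₀ := initialTime N B with ht₀
  have hinv : Tendsto (fun V : ℝ => (√V)⁻¹) atTop (𝓝 0) :=
    Real.tendsto_sqrt_atTop.inv_tendsto_atTop
  have hlog : Tendsto (fun V : ℝ => Real.log V / √V) atTop (𝓝 0) := by
    have := (isLittleO_log_rpow_atTop (r := 1 / 2) (by norm_num)).tendsto_div_nhds_zero
    simpa only [Real.sqrt_eq_rpow] using this
  have hlog2 : Tendsto (fun V : ℝ => Real.log (t₀ + 2 * V) / √V) atTop (𝓝 0) := by
    have hup : Tendsto (fun V : ℝ => Real.log 3 * (√V)⁻¹ + Real.log V / √V) atTop (𝓝 0) := by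
      simpa using (hinv.const_mul (Real.log 3)).add hlog
    refine tendsto_of_tendsto_of_tendsto_of_le_of_le' tendsto_const_nhds hup ?_ ?_
    · filter_upwards [eventually_ge_atTop 0] with V hV
      exact div_nonneg (Real.log_nonneg (by linarith)) (Real.sqrt_nonneg _)
    · filter_upwards [eventually_ge_atTop t₀] with V hV
      have hV0 : 0 < V := by linarith
      rw [← div_eq_mul_inv, ← add_div, ← Real.log_mul (by norm_num) hV0.ne']
      gcongr
      linarith
  have hmax := (hinv.max (hlog2.add (hinv.const_mul (2 * Real.log N)))).const_mul (144 * B)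
  simp only [mul_zero, add_zero, max_self] at hmax
  refine hmax.congr' ?_
  filter_upwards [eventually_gt_atTop 0] with V hV
  have hs : 0 < √V := Real.sqrt_pos.2 hV
  have h1 : √V / V = (√V)⁻¹ := by rw [Real.sqrt_div_self', one_div]
  have h2 : max (√V)⁻¹ (Real.log (t₀ + 2 * V) / √V + 2 * Real.log N * (√V)⁻¹) =
      max 1 (Real.log (t₀ + 2 * V) + 2 * Real.log N) * (√V)⁻¹ := by
    rw [max_mul_of_nonneg _ _ (inv_nonneg.2 hs.le), one_mul, add_mul, div_eq_mul_inv]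
  rw [h2, mul_div_assoc, h1, iotaFactor]
  ring

theorem tendsto_mainBound_div_improvedBound (N : ℕ) {B : ℝ} (hB : 0 ≤ B) {ε : ℝ} (hε : 0 < ε)
    (hε1 : ε < 1) :
    Tendsto (fun V : ℝ => mainBound N B V ε / improvedBound N B V ε) atTop (𝓝 √2) := by
  have ht₀1 := one_le_initialTime N B
  have hlogε : 0 < Real.log (1 / ε) := Real.log_pos (one_lt_one_div hε hε1)
  have hc : Tendsto (fun V : ℝ => initialTime N B / V) atTop (𝓝 0) :=
    tendsto_const_nhds.div_atTop tendsto_id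
  -- The common logarithmic factor cancels; dividing by `V` leaves `√(2 / 1)` in the limit.
  have hquot := ((hc.add_const 2).div ((hc.add_const 1).add (tendsto_iotaFactor_mul_sqrt_div N B))
    (by norm_num)).sqrt
  norm_num at hquot
  refine hquot.congr' ?_
  filter_upwards [eventually_gt_atTop 0] with V hV
  have hpos : 0 < Real.log (initialTime N B + 2 * V) + 2 * Real.log (1 / ε) := by
    have : 0 ≤ Real.log (initialTime N B + 2 * V) := Real.log_nonneg (by linarith)
    linarith
  rw [mainBound, improvedBound, ← Real.sqrt_div' _ (by unfold iotaFactor; positivity),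
    mul_div_mul_right _ _ hpos.ne']
  congr 1
  rw [← mul_div_mul_right _ _ hV.ne']
  congr 1
  · field_simp
  · field_simp

theorem mainTheorem4 (N : ℕ) (hN : 1 ≤ N) (B : ℝ) (hB : 0 ≤ B) :
    (∀ (d ℓ : ℕ → Fin N → ℝ), (∀ j, d j ∈ stdSimplex ℝ (Fin N)) →
      (∀ j i i', |ℓ j i - ℓ j i'| ≤ B) →
      ∀ (ε : ℝ), 0 < ε → ε < 1 → ∀ (T : ℕ), 1 ≤ T →
        quantileRegret (normalHedgeBH B d ℓ T).x ε ≤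
          improvedBound N B (normalHedgeBH B d ℓ T).V ε) ∧
    (∀ (ε : ℝ), 0 < ε → ε < 1 →
      Tendsto (fun V : ℝ => mainBound N B V ε / improvedBound N B V ε) atTop (𝓝 √2)) :=
  ⟨fun _ _ hd hℓ _ hε hε1 T _ => quantileRegret_normalHedgeBH_le hN hB hd hℓ hε hε1 T,
    fun _ hε hε1 => tendsto_mainBound_div_improvedBound N hB hε hε1⟩
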